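/- **Setting.** Let $\mathfrak S$ be a finite or countable set and let $\mathbb Q$ be the distribution of a stochastic process $(X_n)_{n\ge 1}$ with values in $\mathfrak S$. Let $T$ be the rooted tree whose vertices are the finite words $x=s_1\cdots s_n$ ($n\ge 0$, $s_i\in\mathfrak S$) with $\mathbb P[X_1=s_1,\dots,X_n=s_n]>0$; the root $o$ is the empty word and the predecessor of $s_1\cdots s_n$ ($n \ge 1$) is $s_1\cdots s_{n-1}$. Write $|x|=n$ for the length of the word $x$, $S(n)=\{x\in T:|x|=n\}$, and $N(x)$ for the set of successors of $x$. Let $q(y|x)$, $x \in T$, $y\in N(x)$, be the transition probabilities of the process, that is, the conditional probability that $(X_1,\dots,X_{|x|+1})$ is $y$ given that $(X_1,\dots,X_{|x|})$ is $x$. Let $\ell:T\to(0,\infty)$ be a length function (every edge from $x$ to a successor has length $\ell(x)$), and let $|x|_\ell=\sum_{k=0}^{n-1}\ell(s_1\cdots s_k)$ for $x=s_1\cdots s_n$. For each $x\in T$ let $q'(\cdot|x)$ be a further probability distribution on $N(x)$ (zeros are allowed). For transition probabilities $r(\cdot|\cdot)$ on $T$ write $$H_r(x)=\sum_{y\in N(x)}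 r(y|x)\log_2\frac1{r(y|x)},\qquad D_{q',q}(x)=\sum_{y\in N(x)}q'(y|x)\log_2\frac{q'(y|x)}{q(y|x)},$$ with the convention that terms with $r(y|x)=0$, resp. $q'(y|x)=0$, are $0$. A family of functions $g(\cdot|x):N(x)\to\mathbb R$, $x\in T$, is called *tight* (or *uniformly summable*) if for every $\eta>0$ there is an integer $M_\eta \ge 1$ such that for each $x\in T$ there is $N_\eta(x)\subset N(x)$ with $|N_\eta(x)|\le M_\eta$ and $\sum_{y\in N(x)\setminus N_\eta(x)}|g(y|x)|<\eta$. Let $(\varepsilon_n)_{n\ge0}$ be a sequence of random variables on a probability space with values in $[0,1]$, and consider the random transition probabilities $$p(y|x)=(1-\varepsilon_{|x|})\,q(y|x)+\varepsilon_{|x|}\,q'(y|x),\qquad x\in T,\ y\in N(x).$$ Let $\mathbb P_n$ be the random probability distribution that they induce on $S(n)$, $\mathbb P_n(s_1\cdots s_n)=\prod_{k=1}^{n}p(s_1\cdots s_k\,|\,s_1\cdots s_{k-1})$, and put $$H(\mathbb P_n)=\sum_{x\in S(n)}\mathbb P_n(x)\log_2\frac1{\mathbb P_n(x)},\qquad \ell(\mathbb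 P_n)=\sum_{x\in S(n)}|x|_\ell\,\mathbb P_n(x).$$ **Theorem 5.5.** Assume that the families $q(\cdot|x)$ and $q'(\cdot|x)$, $x\in T$, are tight, that the series defining $H_q(x)$ and $H_{q'}(x)$, $x\in T$, are uniformly summable, and that 1. $\ell$ is comparable with the standard length function $\ell_\sharp\equiv1$: there are $0<c_1\le c_2<\infty$ with $c_1\le\ell(x)\le c_2$ for all $x\in T$; 2. the limit $h=\lim_{|x|\to\infty}H_q(x)/\ell(x)$ exists and is finite, that is, for every $\eta>0$ there is $k$ such that $|H_q(x)/\ell(x)-h|<\eta$ for all $x\in T$ with $|x|\ge k$; 3. there is $D<\infty$ such that for all $x\in T$ the series defining $D_{q',q}(x)$ converges absolutely and $D_{q',q}(x)<D$. Then $H(\mathbb P_n)$ and $\ell(\mathbb P_n)$ are finite for every $n$ and every realisation of $(\varepsilon_n)$, the quotient $H(\mathbb P_n)/\ell(\mathbb P_n)$ (set to $0$ for $n=0$) is a random variable, and: * if $\lim_{n\to\infty}\mathsf E(\varepsilon_n)=0$, then $H(\mathbb P_n)/\ell(\mathbb P_n)\to h$ in probability; * if $\varepsilon_n\to0$ almost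 surely, then $\lim_{n\to\infty}H(\mathbb P_n)/\ell(\mathbb P_n)=h$ almost surely, that is, the limit $h(\mathbb P,\ell)$ of these quotients exists and equals $h$ for almost every realisation of $(\varepsilon_n)$. -/

import Mathlib

open MeasureTheory Filter Topology

namespace TrajTree

noncomputable section

/-! ### Entropy and relative entropy (base 2) on a countable set -/

/-- `∑ ν(a) log₂ (1/ν(a))`, where a term with `ν(a) = 0` is `0`. -/
def entropy {α : Type*} (ν : α → ℝ) : ℝ :=
  ∑' a, ν a * Real.logb 2 (1 / ν a)

/-- `∑ ν(a) log₂ (ν(a)/κ(a))`, where a term with `ν(a) = 0` is `0`. -/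
def divergence {α : Type*} (ν κ : α → ℝ) : ℝ :=
  ∑' a, ν a * Real.logb 2 (ν a / κ a)

/-! ### The tree of active finite words of a process

`Q` is the distribution of a process `(X_1, X_2, …)` on its trajectory space `ℕ → S` (the time
index of the paths is shifted to start at `0`). Vertices of the tree are finite words over `S`. -/

variable {S : Type*} [MeasurableSpace S]

/-- The trajectories that start with the word `x`. -/
def wordCylinder (x : List S) : Set (ℕ → S) :=
  {ξ | ∀ i : Fin x.length, ξ i = x.get i}

/-- The vertex set: all words `s_1 … s_n`, `n ≥ 0`, with `P[X_1 = s_1, …, X_n = s_n] > 0`. The root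
is the empty word, the predecessor of a nonempty word is the word without its last letter. -/
def vertices (Q : Measure (ℕ → S)) : Set (List S) :=
  {x | 0 < Q.real (wordCylinder x)}

/-- `N(x)`, the set of successors (forward neighbours) of `x`. -/
def successors (Q : Measure (ℕ → S)) (x : List S) : Set (List S) :=
  {y | y ∈ vertices Q ∧ ∃ s : S, y = x ++ [s]}

/-- `S(n)`, the set of vertices at height `n`. The tree has no leaves. -/
def level (Q : Measure (ℕ → S)) (n : ℕ) : Set (List S) :=
  {x | x ∈ vertices Q ∧ x.length = n}

/-- The forward transition probabilities `q(y|x)` of the process, written `transition Q y x`. -/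
def transition (Q : Measure (ℕ → S)) (y x : List S) : ℝ :=
  Q.real (wordCylinder y) / Q.real (wordCylinder x)

/-- `p` restricted to the tree is a system of forward transition probabilities: each `p(·|x)` is
a probability distribution on `N(x)` (zeros are allowed). -/
def IsForward (Q : Measure (ℕ → S)) (p : List S → List S → ℝ) : Prop :=
  ∀ x ∈ vertices Q, (∀ y ∈ successors Q x, 0 ≤ p y x) ∧
    HasSum (fun y : successors Q x => p y x) 1

/-- The family of functions `g(·|x)` on `N(x)`, `x` a vertex, is tight, or uniformly (absolutely)
summable. -/
def UniformlySummable (Q : Measure (ℕ → S)) (g : List S → List S → ℝ) : Prop :=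
  ∀ ε : ℝ, 0 < ε → ∃ M : ℕ, 1 ≤ M ∧ ∀ x ∈ vertices Q, ∃ F : Finset (List S),
    (F : Set (List S)) ⊆ successors Q x ∧ F.card ≤ M ∧
    Summable (fun y : ↥(successors Q x \ (F : Set (List S))) => |g y x|) ∧
    ∑' y : ↥(successors Q x \ (F : Set (List S))), |g y x| < ε

/-- The terms of the local entropies, `(y, x) ↦ p(y|x) log₂ (1/p(y|x))`. -/
def entropyTerm (p : List S → List S → ℝ) (y x : List S) : ℝ :=
  p y x * Real.logb 2 (1 / p y x)

/-- The local entropy `H_p(x)` of `p(·|x)` on `N(x)`. -/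
def localEntropy (Q : Measure (ℕ → S)) (p : List S → List S → ℝ) (x : List S) : ℝ :=
  entropy (fun y : successors Q x => p y x)

/-- The local relative entropy `D(p(·|x) ‖ q(·|x))` on `N(x)`. -/
def localDivergence (Q : Measure (ℕ → S)) (p q : List S → List S → ℝ) (x : List S) : ℝ :=
  divergence (fun y : successors Q x => p y x) (fun y : successors Q x => q y x)

/-- The length `|x|_ℓ` of the geodesic from the root to `x`, where all edges from a vertex `z`
to its successors have length `ℓ z`. -/
def pathLength (ℓ : List S → ℝ) (x : List S) : ℝ :=
  ∑ k ∈ Finset.range x.length, ℓ (x.take k)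

/-- The mass that the measure on the boundary induced by the transition probabilities `p` gives to
the boundary of the branch at `x`: the product of `p` along the geodesic from the root to `x`. -/
def branchMass (p : List S → List S → ℝ) (x : List S) : ℝ :=
  ∏ k ∈ Finset.range x.length, p (x.take (k + 1)) (x.take k)

/-- The distribution on `S(n)` induced by the transition probabilities `p`. -/
def levelMeasure (Q : Measure (ℕ → S)) (p : List S → List S → ℝ) (n : ℕ) (x : level Q n) : ℝ :=
  branchMass p x

/-- The expected length of the section `S(n)` under the distribution induced by `p`. -/
def expectedLength (Q : Measure (ℕ → S)) (ℓ : List S → ℝ) (p : List S → List S → ℝ) (n : ℕ) : ℝ :=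
  ∑' x : level Q n, pathLength ℓ x * levelMeasure Q p n x

/-- The perturbed transition probabilities `(1 - ε_n) q(y|x) + ε_n q'(y|x)` for `x ∈ S(n)`, for one
realisation `ε` of the sequence of perturbation probabilities. -/
def perturbed (Q : Measure (ℕ → S)) (q' : List S → List S → ℝ) (ε : ℕ → ℝ) (y x : List S) : ℝ :=
  (1 - ε x.length) * transition Q y x + ε x.length * q' y x

end

end TrajTree

/-!
For a system `p` of forward transition probabilities, the chain rule for entropy gives
`H(P_n) = ∑_{k < n} ∑_{x ∈ S(k)} P_k(x) H_p(x)` and likewise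
`ℓ(P_n) = ∑_{k < n} ∑_{x ∈ S(k)} P_k(x) ℓ(x)`. Hence, if `|H_p(x) - h ℓ(x)| ≤ d |x|` for every
vertex `x`, then `|H(P_n) - h ℓ(P_n)| ≤ d 0 + ⋯ + d (n - 1)`
(`IsForward.entropy_sub_expectedLength`), while `ℓ(P_n) ≥ c₁ n`. The quotient therefore differs
from `h` by at most `1 / c₁` times the average of `d 0, …, d (n - 1)`.

For the perturbed transition probabilities one may take `d k = φ (ε k) + δ k`. The sequence `δ`
bounds `|H_q(x) - h ℓ(x)|` on the levels of the tree; it is deterministic and tends to `0` because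
`H_q / ℓ` tends to `h` (`exists_tendsto_zero_bound`). The function `φ` bounds the change of the
local entropy: concavity and subadditivity of `t ↦ -t log t` show that the entropy of the mixture
`(1 - t) q + t q'` lies between `(1 - t) H_q + t H_{q'}` and that number plus the binary entropy of
`t` (`hasSum_negMulLog_mix`). Uniform summability of the entropy series bounds `H_q` and `H_{q'}` by
a constant `B` (`IsForward.exists_localEntropy_le`), so that `φ t = B t + h₂(t)`, with `h₂` the
binary entropy in bits, will do (`mixBound`).

As `φ` is continuous with `φ 0 = 0`, almost sure convergence `ε n → 0` gives `d n → 0`, and the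
averages follow (Cesàro). As `φ` is also concave, Jensen's inequality bounds `E φ(ε n)` by
`φ (E ε n)` (`tendsto_integral_mixBound`), so that under `E ε n → 0` the averages tend to `0` in
mean, hence the quotients converge in probability.
-/

namespace TrajTree

/-! ### Entropy terms -/

open Real in
theorem mul_logb_two_one_div (t : ℝ) : t * logb 2 (1 / t) = negMulLog t / log 2 := by
  simp only [negMulLog, logb, one_div, log_inv]
  ring

open Real in
theorem negMulLog_add_le {a b : ℝ} (ha : 0 ≤ a) (hb : 0 ≤ b) :
    negMulLog (a + b) ≤ negMulLog a + negMulLog b := by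
  have key : ∀ {s t : ℝ}, 0 ≤ s → 0 ≤ t → s * log s ≤ s * log (s + t) := fun {s t} hs ht => by
    rcases hs.eq_or_lt with rfl | hs
    · simp
    · exact mul_le_mul_of_nonneg_left (log_le_log hs (by linarith)) hs.le
  have h₁ := key ha hb
  have h₂ := key hb ha
  rw [add_comm b a] at h₂
  simp only [negMulLog]
  linarith

open Real in
theorem le_negMulLog_mix {a b t : ℝ} (ha : 0 ≤ a) (hb : 0 ≤ b) (ht : t ∈ Set.Icc (0 : ℝ) 1) :
    (1 - t) * negMulLog a + t * negMulLog b ≤ negMulLog ((1 - t) * a + t * b) := by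
  simpa using concaveOn_negMulLog.2 (Set.mem_Ici.2 ha) (Set.mem_Ici.2 hb)
    (sub_nonneg.2 ht.2) ht.1 (by ring)

open Real in
/-- Subadditivity of `negMulLog`, with the weights of the mixture split off. Summed over a
probability distribution, the last two terms make up the binary entropy of `t`. -/
theorem negMulLog_mix_le {a b t : ℝ} (ha : 0 ≤ a) (hb : 0 ≤ b) (ht : t ∈ Set.Icc (0 : ℝ) 1) :
    negMulLog ((1 - t) * a + t * b) ≤
      ((1 - t) * negMulLog a + t * negMulLog b) + (negMulLog (1 - t) * a + negMulLog t * b) := by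
  refine (negMulLog_add_le (mul_nonneg (sub_nonneg.2 ht.2) ha) (mul_nonneg ht.1 hb)).trans_eq ?_
  rw [negMulLog_mul, negMulLog_mul]
  ring

open Real in
/-- The entropy of a mixture lies above the mixture of the entropies, by at most the binary entropy
of the weight. -/
theorem hasSum_negMulLog_mix {α : Type*} {a b : α → ℝ} {t Ha Hb : ℝ} (ha : ∀ i, 0 ≤ a i)
    (hb : ∀ i, 0 ≤ b i) (ha₁ : HasSum a 1) (hb₁ : HasSum b 1) (ht : t ∈ Set.Icc (0 : ℝ) 1)
    (hHa : HasSum (fun i => negMulLog (a i)) Ha) (hHb : HasSum (fun i => negMulLog (b i)) Hb) :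
    ∃ H, HasSum (fun i => negMulLog ((1 - t) * a i + t * b i)) H ∧
      (1 - t) * Ha + t * Hb ≤ H ∧ H ≤ (1 - t) * Ha + t * Hb + binEntropy t := by
  have hlow := (hHa.mul_left (1 - t)).add (hHb.mul_left t)
  have hup := hlow.add ((ha₁.mul_left (negMulLog (1 - t))).add (hb₁.mul_left (negMulLog t)))
  have hl := fun i => le_negMulLog_mix (ha i) (hb i) ht
  have hu := fun i => negMulLog_mix_le (ha i) (hb i) ht
  have hs : Summable fun i => negMulLog ((1 - t) * a i + t * b i) := by
    have : Summable fun i => negMulLog ((1 - t) * a i + t * b i) -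
        ((1 - t) * negMulLog (a i) + t * negMulLog (b i)) :=
      Summable.of_nonneg_of_le (fun i => sub_nonneg.2 (hl i))
        (fun i => sub_le_iff_le_add'.2 (hu i))
        ((ha₁.mul_left (negMulLog (1 - t))).add (hb₁.mul_left (negMulLog t))).summable
    simpa using this.add hlow.summable
  refine ⟨_, hs.hasSum, hasSum_le hl hlow hs.hasSum, ?_⟩
  refine (hasSum_le hu hs.hasSum hup).trans_eq ?_
  rw [binEntropy_eq_negMulLog_add_negMulLog_one_sub]
  ring

/-! ### The tree of a process -/

variable {S : Type*}

theorem mem_wordCylinder {x : List S} {ξ : ℕ → S} :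
    ξ ∈ wordCylinder x ↔ ∀ (i : ℕ) (hi : i < x.length), ξ i = x[i] :=
  ⟨fun h i hi => h ⟨i, hi⟩, fun h i => h i i.2⟩

theorem wordCylinder_append_singleton (x : List S) (s : S) :
    wordCylinder (x ++ [s]) = wordCylinder x ∩ {ξ | ξ x.length = s} := by
  ext ξ
  simp only [Set.mem_inter_iff, mem_wordCylinder, Set.mem_ofPred_eq, List.length_append,
    List.length_singleton]
  constructor
  · intro h
    refine ⟨fun i hi => ?_, ?_⟩
    · rw [h i (by omega), List.getElem_append_left hi]
    · rw [h x.length (by omega)]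
      simp
  · rintro ⟨h, hs⟩ i hi
    rcases Nat.lt_or_ge i x.length with hi' | hi'
    · rw [h i hi', List.getElem_append_left hi']
    · obtain rfl : i = x.length := by omega
      simpa using hs

theorem wordCylinder_nil : wordCylinder ([] : List S) = Set.univ := by
  ext ξ
  simp [mem_wordCylinder]

theorem branchMass_append (p : List S → List S → ℝ) (x : List S) (s : S) :
    branchMass p (x ++ [s]) = branchMass p x * p (x ++ [s]) x := by
  simp only [branchMass, List.length_append, List.length_singleton, Finset.prod_range_succ]
  congr 1
  · refine Finset.prod_congr rfl fun k hk => ?_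
    have hk := Finset.mem_range.1 hk
    rw [List.take_append_of_le_length (by omega), List.take_append_of_le_length (by omega)]
  · rw [List.take_of_length_le (by simp), List.take_left]

theorem pathLength_append (ℓ : List S → ℝ) (x : List S) (s : S) :
    pathLength ℓ (x ++ [s]) = pathLength ℓ x + ℓ x := by
  simp only [pathLength, List.length_append, List.length_singleton, Finset.sum_range_succ]
  congr 1
  · refine Finset.sum_congr rfl fun k hk => ?_
    have hk := Finset.mem_range.1 hk
    rw [List.take_append_of_le_length (by omega)]
  · rw [List.take_left]

variable [MeasurableSpace S] {Q : Measure (ℕ → S)}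

theorem measurableSet_wordCylinder [MeasurableSingletonClass S] (x : List S) :
    MeasurableSet (wordCylinder x) := by
  have : wordCylinder x = ⋂ i : Fin x.length, (fun ξ : ℕ → S => ξ i) ⁻¹' {x.get i} := by
    ext ξ
    simp [wordCylinder]
  rw [this]
  exact MeasurableSet.iInter fun i => measurable_pi_apply _ (measurableSet_singleton _)

theorem hasSum_wordCylinder [Countable S] [MeasurableSingletonClass S] [IsProbabilityMeasure Q]
    (x : List S) :
    HasSum (fun s => Q.real (wordCylinder (x ++ [s]))) (Q.real (wordCylinder x)) := by
  have hU : wordCylinder x = ⋃ s, wordCylinder (x ++ [s]) := by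
    ext ξ
    simp [wordCylinder_append_singleton]
  have hd : Pairwise (Function.onFun Disjoint fun s => wordCylinder (x ++ [s])) := by
    intro s t hst
    refine Set.disjoint_left.2 fun ξ hs ht => hst ?_
    simp only [wordCylinder_append_singleton] at hs ht
    exact hs.2.symm.trans ht.2
  have hQ := measure_iUnion (μ := Q) hd fun s => measurableSet_wordCylinder (x ++ [s])
  rw [← hU] at hQ
  have := ENNReal.hasSum_toReal (f := fun s => Q (wordCylinder (x ++ [s])))
    (by rw [← hQ]; exact measure_ne_top _ _)
  rw [← ENNReal.tsum_toReal_eq (fun s => measure_ne_top _ _), ← hQ] at this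
  exact this

theorem nil_mem_vertices [IsProbabilityMeasure Q] : [] ∈ vertices Q := by
  simp [vertices, wordCylinder_nil]

theorem mem_vertices_of_append [IsProbabilityMeasure Q] {x : List S} {s : S}
    (h : x ++ [s] ∈ vertices Q) : x ∈ vertices Q := by
  refine lt_of_lt_of_le h (measureReal_mono ?_)
  rw [wordCylinder_append_singleton]
  exact Set.inter_subset_left

theorem take_mem_vertices [IsProbabilityMeasure Q] {x : List S} (hx : x ∈ vertices Q) (k : ℕ) :
    x.take k ∈ vertices Q := by
  induction x using List.reverseRecOn with
  | nil => simpa using hx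
  | append_singleton x s ih =>
    rcases Nat.lt_or_ge x.length k with hk | hk
    · rwa [List.take_of_length_le (by simpa using hk)]
    · rw [List.take_append_of_le_length hk]
      exact ih (mem_vertices_of_append hx)

theorem isForward_transition [Countable S] [MeasurableSingletonClass S] [IsProbabilityMeasure Q] :
    IsForward Q (transition Q) := by
  intro x hx
  refine ⟨fun y _ => div_nonneg measureReal_nonneg measureReal_nonneg, ?_⟩
  choose g hg using fun y : successors Q x => y.2.2
  have hinj : Function.Injective g := fun y z h => Subtype.ext (by rw [hg y, hg z, h])
  have hx0 : Q.real (wordCylinder x) ≠ 0 := ne_of_gt hx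
  have hsum := (hinj.hasSum_iff (fun s hs => by
    by_contra hne
    refine hs ⟨⟨x ++ [s], lt_of_le_of_ne measureReal_nonneg (Ne.symm hne), s, rfl⟩, ?_⟩
    simpa using (hg ⟨x ++ [s], _⟩).symm)).2 (hasSum_wordCylinder (Q := Q) x)
  have := hsum.div_const (Q.real (wordCylinder x))
  rw [div_self hx0] at this
  refine this.congr_fun fun y => ?_
  simp only [transition, Function.comp, ← hg y]

theorem IsForward.le_one {p : List S → List S → ℝ} (hp : IsForward Q p) {x y : List S}
    (hx : x ∈ vertices Q) (hy : y ∈ successors Q x) : p y x ≤ 1 :=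
  le_hasSum (hp x hx).2 ⟨y, hy⟩ fun z _ => (hp x hx).1 z z.2

theorem IsForward.perturbed {q' : List S → List S → ℝ} (hq : IsForward Q (transition Q))
    (hq' : IsForward Q q') {e : ℕ → ℝ} (he : ∀ k, e k ∈ Set.Icc (0 : ℝ) 1) :
    IsForward Q (perturbed Q q' e) := by
  intro x hx
  refine ⟨fun y hy => add_nonneg (mul_nonneg (sub_nonneg.2 (he _).2) ((hq x hx).1 y hy))
    (mul_nonneg (he _).1 ((hq' x hx).1 y hy)), ?_⟩
  simpa [TrajTree.perturbed] using
    ((hq x hx).2.mul_left (1 - e x.length)).add ((hq' x hx).2.mul_left (e x.length))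

/-- The vertices at height `n + 1` are the pairs of a vertex at height `n` and one of its
successors. -/
def levelSuccEquiv (Q : Measure (ℕ → S)) [IsProbabilityMeasure Q] (n : ℕ) :
    (Σ x : level Q n, successors Q (x : List S)) ≃ level Q (n + 1) where
  toFun z := ⟨z.2, z.2.2.1, by
    obtain ⟨s, hs⟩ := z.2.2.2
    rw [hs, List.length_append, z.1.2.2, List.length_singleton]⟩
  invFun y := ⟨⟨y.1.take n, take_mem_vertices y.2.1 n, by simp [y.2.2]⟩,
    ⟨y.1, y.2.1, y.1[n]'(by simp [y.2.2]), by
      rw [List.take_append_getElem, List.take_of_length_le (by simp [y.2.2])]⟩⟩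
  left_inv := by
    rintro ⟨⟨x, hx⟩, ⟨y, hy⟩⟩
    obtain ⟨s, rfl⟩ := hy.2
    obtain ⟨hx, rfl⟩ := hx
    refine Sigma.subtype_ext (Subtype.ext ?_) rfl
    simp
  right_inv y := rfl

theorem hasSum_level_zero [IsProbabilityMeasure Q] (f : List S → ℝ) :
    HasSum (fun x : level Q 0 => f x) (f []) := by
  have : ∀ x : level Q 0, x = ⟨[], nil_mem_vertices, rfl⟩ := fun x =>
    Subtype.ext (List.length_eq_zero_iff.1 x.2.2)
  exact hasSum_single (f := fun x : level Q 0 => f x) ⟨[], nil_mem_vertices, rfl⟩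
    fun x hx => absurd (this x) hx

/-- Summation over `S(n + 1)`, successor set by successor set. -/
theorem hasSum_level_succ [IsProbabilityMeasure Q] {n : ℕ} {f g : List S → ℝ} {a : ℝ}
    (hf : ∀ y ∈ level Q (n + 1), 0 ≤ f y)
    (hfg : ∀ x ∈ level Q n, HasSum (fun y : successors Q x => f y) (g x))
    (hg : HasSum (fun x : level Q n => g x) a) :
    HasSum (fun y : level Q (n + 1) => f y) a := by
  rw [← (levelSuccEquiv Q n).hasSum_iff]
  refine hg.sigma_of_hasSum (fun x => hfg x x.2) ?_
  refine (summable_sigma_of_nonneg fun z => hf _ (levelSuccEquiv Q n z).2).2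
    ⟨fun x => (hfg x x.2).summable, ?_⟩
  refine hg.summable.congr fun x => ?_
  exact (hfg x x.2).tsum_eq.symm

/-! ### Distributions on the levels -/

variable {p : List S → List S → ℝ}

theorem IsForward.branchMass_mem [IsProbabilityMeasure Q] (hp : IsForward Q p) {x : List S}
    (hx : x ∈ vertices Q) : 0 ≤ branchMass p x ∧ branchMass p x ≤ 1 := by
  induction x using List.reverseRecOn with
  | nil => simp [branchMass]
  | append_singleton x s ih =>
    have hx' := mem_vertices_of_append hx
    have hs : x ++ [s] ∈ successors Q x := ⟨hx, s, rfl⟩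
    rw [branchMass_append]
    have h0 := (hp x hx').1 _ hs
    exact ⟨mul_nonneg (ih hx').1 h0, mul_le_one₀ (ih hx').2 h0 (hp.le_one hx' hs)⟩

theorem IsForward.hasSum_levelMeasure [IsProbabilityMeasure Q] (hp : IsForward Q p) (n : ℕ) :
    HasSum (levelMeasure Q p n) 1 := by
  induction n with
  | zero => exact hasSum_level_zero (branchMass p)
  | succ n ih =>
    refine hasSum_level_succ (fun y hy => (hp.branchMass_mem hy.1).1) (fun x hx => ?_) ih
    have := (hp x hx.1).2.mul_left (branchMass p x)
    rw [mul_one] at this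
    refine this.congr_fun fun y => ?_
    obtain ⟨s, hs⟩ := y.2.2
    rw [hs, branchMass_append]

theorem IsForward.summable_mul_levelMeasure [IsProbabilityMeasure Q] (hp : IsForward Q p) {n : ℕ}
    {w : List S → ℝ} {C : ℝ} (hw : ∀ x ∈ level Q n, |w x| ≤ C) :
    Summable fun x : level Q n => w x * levelMeasure Q p n x := by
  refine Summable.of_norm_bounded ((hp.hasSum_levelMeasure n).summable.mul_left C) fun x => ?_
  have h0 : 0 ≤ levelMeasure Q p n x := (hp.branchMass_mem x.2.1).1
  rw [Real.norm_eq_abs, abs_mul, abs_of_nonneg h0]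
  exact mul_le_mul_of_nonneg_right (hw x x.2) h0

open Real in
/-- Chain rule: the entropy of the distribution on `S(n + 1)` is the one on `S(n)` plus the
expected local entropy. -/
theorem IsForward.hasSum_negMulLog_succ [IsProbabilityMeasure Q] (hp : IsForward Q p)
    {G : List S → ℝ}
    (hG : ∀ x ∈ vertices Q, HasSum (fun y : successors Q x => negMulLog (p y x)) (G x))
    {n : ℕ} {a b : ℝ} (ha : HasSum (fun x : level Q n => negMulLog (levelMeasure Q p n x)) a)
    (hb : HasSum (fun x : level Q n => G x * levelMeasure Q p n x) b) :
    HasSum (fun x : level Q (n + 1) => negMulLog (levelMeasure Q p (n + 1) x)) (a + b) := by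
  refine hasSum_level_succ (f := fun y => negMulLog (branchMass p y))
    (g := fun x => negMulLog (branchMass p x) + G x * branchMass p x)
    (fun y hy => negMulLog_nonneg (hp.branchMass_mem hy.1).1 (hp.branchMass_mem hy.1).2)
    (fun x hx => ?_) (ha.add hb)
  have := ((hp x hx.1).2.mul_right (negMulLog (branchMass p x))).add
    ((hG x hx.1).mul_right (branchMass p x))
  rw [one_mul] at this
  refine this.congr_fun fun y => ?_
  obtain ⟨s, hs⟩ := y.2.2
  rw [hs, branchMass_append, negMulLog_mul]
  ring

theorem IsForward.hasSum_pathLength_succ [IsProbabilityMeasure Q] (hp : IsForward Q p)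
    {ℓ : List S → ℝ} (hℓ : ∀ x ∈ vertices Q, 0 ≤ ℓ x) {n : ℕ} {a b : ℝ}
    (ha : HasSum (fun x : level Q n => pathLength ℓ x * levelMeasure Q p n x) a)
    (hb : HasSum (fun x : level Q n => ℓ x * levelMeasure Q p n x) b) :
    HasSum (fun x : level Q (n + 1) => pathLength ℓ x * levelMeasure Q p (n + 1) x) (a + b) := by
  refine hasSum_level_succ (f := fun y => pathLength ℓ y * branchMass p y)
    (g := fun x => pathLength ℓ x * branchMass p x + ℓ x * branchMass p x)
    (fun y hy => mul_nonneg (Finset.sum_nonneg fun k _ => hℓ _ (take_mem_vertices hy.1 k))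
      (hp.branchMass_mem hy.1).1)
    (fun x hx => ?_) (ha.add hb)
  have := (hp x hx.1).2.mul_left ((pathLength ℓ x + ℓ x) * branchMass p x)
  rw [mul_one, add_mul] at this
  refine this.congr_fun fun y => ?_
  obtain ⟨s, hs⟩ := y.2.2
  rw [hs, branchMass_append, pathLength_append]
  ring

/-- If every local entropy is within `d |x|` of `h ℓ(x)`, then the entropy on `S(n)` is within
`d 0 + ⋯ + d (n - 1)` of `h` times the expected length. -/
theorem IsForward.entropy_sub_expectedLength [IsProbabilityMeasure Q] (hp : IsForward Q p)
    {ℓ : List S → ℝ} {c₁ c₂ : ℝ} (hc₁ : 0 < c₁) (hℓ : ∀ x ∈ vertices Q, c₁ ≤ ℓ x ∧ ℓ x ≤ c₂)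
    {G : List S → ℝ}
    (hG : ∀ x ∈ vertices Q, HasSum (fun y : successors Q x => entropyTerm p y x) (G x))
    {h : ℝ} {d : ℕ → ℝ} (hd : ∀ x ∈ vertices Q, |G x - h * ℓ x| ≤ d x.length) (n : ℕ) :
    Summable (fun x : level Q n =>
      levelMeasure Q p n x * Real.logb 2 (1 / levelMeasure Q p n x)) ∧
    Summable (fun x : level Q n => pathLength ℓ x * levelMeasure Q p n x) ∧
    c₁ * n ≤ expectedLength Q ℓ p n ∧
    |entropy (levelMeasure Q p n) - h * expectedLength Q ℓ p n| ≤
      ∑ k ∈ Finset.range n, d k := by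
  simp only [entropyTerm, expectedLength, entropy, mul_logb_two_one_div] at *
  have hl2 : Real.log 2 ≠ 0 := (Real.log_pos one_lt_two).ne'
  suffices H : ∃ a b,
      HasSum (fun x : level Q n => Real.negMulLog (levelMeasure Q p n x)) (a * Real.log 2) ∧
      HasSum (fun x : level Q n => pathLength ℓ x * levelMeasure Q p n x) b ∧
      c₁ * n ≤ b ∧ |a - h * b| ≤ ∑ k ∈ Finset.range n, d k by
    obtain ⟨a, b, ha, hb, hcb, hab⟩ := H
    have ha' := ha.div_const (Real.log 2)
    rw [mul_div_cancel_right₀ _ hl2] at ha'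
    rw [ha'.tsum_eq, hb.tsum_eq]
    exact ⟨ha'.summable, hb.summable, hcb, hab⟩
  induction n with
  | zero =>
    refine ⟨0, 0, ?_, ?_, by simp, by simp⟩
    · simpa [branchMass, levelMeasure] using
        hasSum_level_zero (Q := Q) fun x => Real.negMulLog (branchMass p x)
    · simpa [branchMass, levelMeasure, pathLength] using
        hasSum_level_zero (Q := Q) fun x => pathLength ℓ x * branchMass p x
  | succ n ih =>
    obtain ⟨a, b, ha, hb, hcb, hab⟩ := ih
    have hℓ0 : ∀ x ∈ vertices Q, 0 ≤ ℓ x := fun x hx => hc₁.le.trans (hℓ x hx).1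
    have hsℓ : Summable fun x : level Q n => ℓ x * levelMeasure Q p n x :=
      hp.summable_mul_levelMeasure fun x hx =>
        (abs_of_nonneg (hℓ0 x hx.1)).trans_le (hℓ x hx.1).2
    have hsd : Summable fun x : level Q n => (G x - h * ℓ x) * levelMeasure Q p n x :=
      hp.summable_mul_levelMeasure (w := fun x => G x - h * ℓ x) fun x hx =>
        hx.2 ▸ hd x hx.1
    have hsG := hsd.hasSum.add (hsℓ.hasSum.mul_left h)
    have h1 := hp.hasSum_levelMeasure n
    have hP0 : ∀ x : level Q n, 0 ≤ levelMeasure Q p n x := fun x => (hp.branchMass_mem x.2.1).1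
    refine ⟨a + (∑' x : level Q n, (G x - h * ℓ x) * levelMeasure Q p n x +
        h * ∑' x : level Q n, ℓ x * levelMeasure Q p n x), _, ?_,
      hp.hasSum_pathLength_succ hℓ0 hb hsℓ.hasSum, ?_, ?_⟩
    rotate_left
    · have := hasSum_le (fun x : level Q n => mul_le_mul_of_nonneg_right (hℓ x x.2.1).1 (hP0 x))
        (h1.mul_left c₁) hsℓ.hasSum
      push_cast
      linarith
    · have hdn : ∀ x : level Q n, |G x - h * ℓ x| ≤ d n := fun x =>
        (hd x x.2.1).trans_eq (congrArg d x.2.2)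
      have hup := hasSum_le (fun x => mul_le_mul_of_nonneg_right (abs_le.1 (hdn x)).2 (hP0 x))
        hsd.hasSum (h1.mul_left (d n))
      have hlow := hasSum_le (fun x => mul_le_mul_of_nonneg_right (abs_le.1 (hdn x)).1 (hP0 x))
        (h1.mul_left (-d n)) hsd.hasSum
      rw [Finset.sum_range_succ]
      rw [abs_le] at hab ⊢
      constructor <;> linarith [hab.1, hab.2]
    · rw [add_mul]
      refine hp.hasSum_negMulLog_succ (G := fun x => G x * Real.log 2) (fun x hx => ?_) ha ?_
      · refine ((hG x hx).mul_right (Real.log 2)).congr_fun fun y => ?_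
        rw [div_mul_cancel₀ _ hl2]
      · refine (hsG.mul_right (Real.log 2)).congr_fun fun x => ?_
        ring

/-! ### Uniform bounds for the local entropies -/

theorem IsForward.entropyTerm_mem {p : List S → List S → ℝ} (hp : IsForward Q p) {x y : List S}
    (hx : x ∈ vertices Q) (hy : y ∈ successors Q x) :
    0 ≤ entropyTerm p y x ∧ entropyTerm p y x ≤ 1 / Real.log 2 := by
  rw [entropyTerm, mul_logb_two_one_div]
  have h0 := (hp x hx).1 y hy
  have hl := Real.log_pos one_lt_two
  refine ⟨div_nonneg (Real.negMulLog_nonneg h0 (hp.le_one hx hy)) hl.le, ?_⟩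
  gcongr
  linarith [Real.negMulLog_le_one_sub_self h0]

/-- Uniform summability bounds the local entropies: all but `M` terms add up to at most `1`, and
each of the remaining terms is at most `1 / log 2`. -/
theorem IsForward.exists_localEntropy_le {p : List S → List S → ℝ} (hp : IsForward Q p)
    (hs : UniformlySummable Q (entropyTerm p)) :
    ∃ B, ∀ x ∈ vertices Q,
      HasSum (fun y : successors Q x => entropyTerm p y x) (localEntropy Q p x) ∧
      0 ≤ localEntropy Q p x ∧ localEntropy Q p x ≤ B := by
  obtain ⟨M, -, hM⟩ := hs 1 one_pos
  refine ⟨M * (1 / Real.log 2) + 1, fun x hx => ?_⟩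
  obtain ⟨F, hF, hcard, hsum, hlt⟩ := hM x hx
  have habs : ∀ y : ↥(successors Q x \ (F : Set (List S))),
      |entropyTerm p y x| = entropyTerm p y x := fun y =>
    abs_of_nonneg (hp.entropyTerm_mem hx y.2.1).1
  simp only [habs] at hsum hlt
  have hu := (Finset.hasSum F fun y => entropyTerm p y x).add_disjoint
    (t := successors Q x \ (F : Set (List S))) Set.disjoint_sdiff_right hsum.hasSum
  rw [Set.union_sdiff_cancel hF] at hu
  have hu' : HasSum (fun y : successors Q x => entropyTerm p y x) _ := hu
  have heq : localEntropy Q p x = _ := hu'.tsum_eq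
  rw [heq]
  refine ⟨hu', hasSum_le (fun y => (hp.entropyTerm_mem hx y.2).1) hasSum_zero hu', ?_⟩
  refine add_le_add ?_ hlt.le
  refine (Finset.sum_le_card_nsmul F _ _ fun y hy => (hp.entropyTerm_mem hx (hF hy)).2).trans ?_
  rw [nsmul_eq_mul]
  have := Real.log_pos one_lt_two
  gcongr

/-- The bound for the change of a local entropy under a perturbation of size `t`, when the local
entropies are at most `B`. -/
noncomputable def mixBound (B t : ℝ) : ℝ := B * t + Real.binEntropy t / Real.log 2

theorem continuous_mixBound (B : ℝ) : Continuous (mixBound B) := by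
  unfold mixBound
  fun_prop

theorem mixBound_zero (B : ℝ) : mixBound B 0 = 0 := by simp [mixBound]

theorem tendsto_mixBound_zero (B : ℝ) : Tendsto (mixBound B) (𝓝 0) (𝓝 0) :=
  (continuous_mixBound B).tendsto' 0 0 (mixBound_zero B)

theorem concaveOn_mixBound (B : ℝ) : ConcaveOn ℝ (Set.Icc 0 1) (mixBound B) := by
  have h₁ : ConcaveOn ℝ (Set.Icc (0 : ℝ) 1) fun t => B * t :=
    ((LinearMap.mul ℝ ℝ) B).concaveOn (convex_Icc 0 1)
  have h₂ := Real.strictConcave_binEntropy.concaveOn.smul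
    (inv_nonneg.2 (Real.log_pos one_lt_two).le)
  refine (h₁.add h₂).congr fun t _ => ?_
  simp [mixBound, div_eq_inv_mul]

theorem abs_sub_le_mixBound {a b H B t : ℝ} (ha : 0 ≤ a ∧ a ≤ B) (hb : 0 ≤ b ∧ b ≤ B)
    (ht : t ∈ Set.Icc (0 : ℝ) 1) (h₁ : (1 - t) * a + t * b ≤ H)
    (h₂ : H ≤ (1 - t) * a + t * b + Real.binEntropy t / Real.log 2) :
    |H - a| ≤ mixBound B t := by
  have h0 : 0 ≤ Real.binEntropy t / Real.log 2 :=
    div_nonneg (Real.binEntropy_nonneg ht.1 ht.2) (Real.log_pos one_lt_two).le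
  have ht0 := ht.1
  rw [abs_le, mixBound]
  constructor <;> nlinarith

/-- The perturbation changes the local entropy at a vertex `x` by at most `mixBound B (e |x|)`,
where `B` bounds the two local entropies that are mixed. -/
theorem hasSum_entropyTerm_perturbed {q' : List S → List S → ℝ} (hq : IsForward Q (transition Q))
    (hq' : IsForward Q q') {e : ℕ → ℝ} (he : ∀ k, e k ∈ Set.Icc (0 : ℝ) 1) {x : List S}
    (hx : x ∈ vertices Q) {a b B : ℝ} (ha : 0 ≤ a ∧ a ≤ B) (hb : 0 ≤ b ∧ b ≤ B)
    (hqa : HasSum (fun y : successors Q x => entropyTerm (transition Q) y x) a)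
    (hqb : HasSum (fun y : successors Q x => entropyTerm q' y x) b) :
    HasSum (fun y : successors Q x => entropyTerm (perturbed Q q' e) y x)
      (localEntropy Q (perturbed Q q' e) x) ∧
    |localEntropy Q (perturbed Q q' e) x - a| ≤ mixBound B (e x.length) := by
  have hl := Real.log_pos one_lt_two
  simp only [entropyTerm, mul_logb_two_one_div] at hqa hqb
  have hqa' := hqa.mul_right (Real.log 2)
  have hqb' := hqb.mul_right (Real.log 2)
  simp only [div_mul_cancel₀ _ hl.ne'] at hqa' hqb'
  obtain ⟨H, hH, h₁, h₂⟩ := hasSum_negMulLog_mix (fun y : successors Q x => (hq x hx).1 y y.2)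
    (fun y => (hq' x hx).1 y y.2) (hq x hx).2 (hq' x hx).2 (he x.length) hqa' hqb'
  have hs : HasSum (fun y : successors Q x => entropyTerm (perturbed Q q' e) y x)
      (H / Real.log 2) := by
    simp only [entropyTerm, mul_logb_two_one_div]
    exact hH.div_const _
  have heq : localEntropy Q (perturbed Q q' e) x = H / Real.log 2 := hs.tsum_eq
  rw [heq]
  refine ⟨hs, abs_sub_le_mixBound ha hb (he _) ?_ ?_⟩
  · rw [le_div_iff₀ hl]
    linarith
  · rw [div_le_iff₀ hl, add_mul, div_mul_cancel₀ _ hl.ne']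
    linarith

/-- The normalised local entropies converge to `h` uniformly on the levels of the tree. -/
theorem exists_tendsto_zero_bound {ℓ G : List S → ℝ} {c₁ c₂ h B : ℝ} (hc₁ : 0 < c₁)
    (hℓ : ∀ x ∈ vertices Q, c₁ ≤ ℓ x ∧ ℓ x ≤ c₂) (hG : ∀ x ∈ vertices Q, 0 ≤ G x ∧ G x ≤ B)
    (hlim : Tendsto (fun x => G x / ℓ x)
      (comap List.length atTop ⊓ 𝓟 (vertices Q)) (𝓝 h)) :
    ∃ δ : ℕ → ℝ, Tendsto δ atTop (𝓝 0) ∧ ∀ x ∈ vertices Q, |G x - h * ℓ x| ≤ δ x.length := by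
  have hbdd : ∀ n, BddAbove (Set.range fun x : level Q n => |G x - h * ℓ x|) := by
    refine fun n => ⟨B + |h| * c₂, ?_⟩
    rintro _ ⟨x, rfl⟩
    have hx := hℓ x x.2.1
    refine (abs_sub _ _).trans (add_le_add ?_ ?_)
    · rw [abs_of_nonneg (hG x x.2.1).1]
      exact (hG x x.2.1).2
    · rw [abs_mul, abs_of_nonneg (hc₁.le.trans hx.1)]
      exact mul_le_mul_of_nonneg_left hx.2 (abs_nonneg h)
  refine ⟨fun n => ⨆ x : level Q n, |G x - h * ℓ x|, ?_, fun x hx =>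
    le_ciSup (hbdd x.length) ⟨x, hx, rfl⟩⟩
  rw [Metric.tendsto_atTop]
  intro η hη
  -- `|c₂| + 1` serves as an upper bound of `ℓ` that is positive even if `vertices Q` is empty
  have hev := hlim (Metric.ball_mem_nhds h (ε := η / 2 / (|c₂| + 1)) (by positivity))
  rw [mem_map, mem_inf_principal, mem_comap] at hev
  obtain ⟨T, hT, hsub⟩ := hev
  obtain ⟨K, hK⟩ := mem_atTop_sets.1 hT
  refine ⟨K, fun n hn => ?_⟩
  have hle : ⨆ x : level Q n, |G x - h * ℓ x| ≤ η / 2 := by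
    refine Real.iSup_le (fun x => ?_) (by positivity)
    have hx := hℓ x x.2.1
    have hpos : 0 < ℓ x := hc₁.trans_le hx.1
    have hb : |G x / ℓ x - h| < η / 2 / (|c₂| + 1) :=
      hsub (show (x : List S).length ∈ T from hK _ (x.2.2.symm ▸ hn)) x.2.1
    have hfac : G x - h * ℓ x = (G x / ℓ x - h) * ℓ x := by field_simp
    rw [hfac, abs_mul, abs_of_pos hpos]
    calc _ ≤ η / 2 / (|c₂| + 1) * (|c₂| + 1) :=
          mul_le_mul hb.le (by linarith [le_abs_self c₂]) hpos.le (by positivity)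
      _ = η / 2 := by field_simp
  have h0 : 0 ≤ ⨆ x : level Q n, |G x - h * ℓ x| := Real.iSup_nonneg fun x => abs_nonneg _
  rw [Real.dist_eq, sub_zero, abs_of_nonneg h0]
  linarith

/-! ### Measurability -/

variable {Ω : Type*} [MeasurableSpace Ω]

theorem measurable_levelMeasure_perturbed (q' : List S → List S → ℝ) {ε : ℕ → Ω → ℝ}
    (hε : ∀ n, Measurable (ε n)) {n : ℕ} (x : level Q n) :
    Measurable fun ω => levelMeasure Q (perturbed Q q' fun k => ε k ω) n x := by
  unfold levelMeasure branchMass perturbed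
  fun_prop

theorem measurable_entropy_div_expectedLength [Countable S] (q' : List S → List S → ℝ)
    (ℓ : List S → ℝ) {ε : ℕ → Ω → ℝ} (hε : ∀ n, Measurable (ε n)) (n : ℕ) :
    Measurable fun ω => entropy (levelMeasure Q (perturbed Q q' fun k => ε k ω) n) /
      expectedLength Q ℓ (perturbed Q q' fun k => ε k ω) n := by
  have hm := measurable_levelMeasure_perturbed (Q := Q) (n := n) q' hε
  refine Measurable.div ?_ ?_
  · simp only [entropy, mul_logb_two_one_div]
    exact Measurable.tsum fun x =>
      (Real.continuous_negMulLog.measurable.comp (hm x)).div_const _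
  · exact Measurable.tsum fun x => (hm x).const_mul _

/-! ### Averages -/

variable {μ : Measure Ω}

/-- Jensen's inequality for the concave function `mixBound B`, which is continuous and vanishes
at `0`. -/
theorem tendsto_integral_mixBound [IsProbabilityMeasure μ] {B : ℝ} {ε : ℕ → Ω → ℝ}
    (hε_meas : ∀ n, Measurable (ε n)) (hε : ∀ n ω, ε n ω ∈ Set.Icc (0 : ℝ) 1) (hB : 0 ≤ B)
    (hlim : Tendsto (fun n => ∫ ω, ε n ω ∂μ) atTop (𝓝 0)) :
    (∀ n, Integrable (fun ω => mixBound B (ε n ω)) μ) ∧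
    Tendsto (fun n => ∫ ω, mixBound B (ε n ω) ∂μ) atTop (𝓝 0) := by
  have hcompact : ∃ C, ∀ t ∈ Set.Icc (0 : ℝ) 1, ‖mixBound B t‖ ≤ C :=
    isCompact_Icc.exists_bound_of_continuousOn (continuous_mixBound B).continuousOn
  obtain ⟨C, hC⟩ := hcompact
  have hint : ∀ n, Integrable (fun ω => mixBound B (ε n ω)) μ := fun n =>
    Integrable.of_bound ((continuous_mixBound B).measurable.comp (hε_meas n)).aestronglyMeasurable
      C (ae_of_all _ fun ω => hC _ (hε n ω))
  have hintε : ∀ n, Integrable (ε n) μ := fun n =>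
    Integrable.of_bound (hε_meas n).aestronglyMeasurable 1 (ae_of_all _ fun ω => by
      rw [Real.norm_eq_abs, abs_of_nonneg (hε n ω).1]
      exact (hε n ω).2)
  refine ⟨hint, squeeze_zero (fun n => integral_nonneg fun ω => ?_) (fun n => ?_)
    ((tendsto_mixBound_zero B).comp hlim)⟩
  · exact add_nonneg (mul_nonneg hB (hε n ω).1) (div_nonneg
      (Real.binEntropy_nonneg (hε n ω).1 (hε n ω).2) (Real.log_pos one_lt_two).le)
  · exact (concaveOn_mixBound B).le_map_integral (continuous_mixBound B).continuousOn isClosed_Icc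
      (ae_of_all _ (hε n)) (hintε n) (hint n)

theorem abs_div_sub_le {a b h c s : ℝ} {n : ℕ} (hn : n ≠ 0) (hc : 0 < c) (hb : c * n ≤ b)
    (hab : |a - h * b| ≤ s) : |a / b - h| ≤ c⁻¹ * ((n : ℝ)⁻¹ * s) := by
  have hn' : (0 : ℝ) < n := by positivity
  have hb' : 0 < b := (mul_pos hc hn').trans_le hb
  have hfac : a / b - h = (a - h * b) / b := by field_simp
  rw [hfac, abs_div, abs_of_pos hb', ← mul_assoc, ← mul_inv, inv_mul_eq_div]
  exact div_le_div₀ ((abs_nonneg _).trans hab) hab (mul_pos hc hn') hb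

/-- Convergence in mean of a bound for the distances forces convergence in measure. -/
theorem tendstoInMeasure_of_abs_sub_le {f g : ℕ → Ω → ℝ} {h : ℝ} (hf : ∀ n, Measurable (f n))
    (hg : ∀ n, Integrable (g n) μ) (hfg : ∀ᶠ n in atTop, ∀ ω, |f n ω - h| ≤ g n ω)
    (hlim : Tendsto (fun n => ∫ ω, g n ω ∂μ) atTop (𝓝 0)) :
    TendstoInMeasure μ f atTop fun _ => h := by
  refine tendstoInMeasure_of_tendsto_eLpNorm one_ne_zero
    (fun n => (hf n).aestronglyMeasurable) aestronglyMeasurable_const ?_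
  have hlim' := (ENNReal.continuous_ofReal.tendsto 0).comp hlim
  rw [ENNReal.ofReal_zero] at hlim'
  refine tendsto_of_tendsto_of_tendsto_of_le_of_le' tendsto_const_nhds hlim'
    (Eventually.of_forall fun n => zero_le) ?_
  filter_upwards [hfg] with n hn
  have hg0 : ∀ ω, 0 ≤ g n ω := fun ω => (abs_nonneg _).trans (hn ω)
  rw [Function.comp, ofReal_integral_eq_lintegral_ofReal (hg n) (ae_of_all _ hg0),
    eLpNorm_one_eq_lintegral_enorm]
  refine lintegral_mono fun ω => ?_
  rw [Real.enorm_eq_ofReal_abs]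
  exact ENNReal.ofReal_le_ofReal (hn ω)

end TrajTree

open TrajTree in
theorem theorem5p5
    {S : Type*} [Countable S] [MeasurableSpace S] [MeasurableSingletonClass S]
    (Q : Measure (ℕ → S)) [IsProbabilityMeasure Q]
    (q' : List S → List S → ℝ) (hq' : IsForward Q q')
    (ℓ : List S → ℝ)
    {Ω : Type*} [MeasurableSpace Ω] (μ : Measure Ω) [IsProbabilityMeasure μ]
    (ε : ℕ → Ω → ℝ) (hε_meas : ∀ n, Measurable (ε n)) (hε : ∀ n ω, ε n ω ∈ Set.Icc (0 : ℝ) 1)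
    -- tightness and uniform summability of the local entropies
    (hq_tight : UniformlySummable Q (transition Q))
    (hq'_tight : UniformlySummable Q q')
    (hq_ent : UniformlySummable Q (entropyTerm (transition Q)))
    (hq'_ent : UniformlySummable Q (entropyTerm q'))
    -- (i) comparability of the length function with the standard one
    (c₁ c₂ : ℝ) (hc₁ : 0 < c₁) (hℓ : ∀ x ∈ vertices Q, c₁ ≤ ℓ x ∧ ℓ x ≤ c₂)
    -- (ii) the limit of normalised local entropies as the height of `x` tends to infinity
    (h : ℝ)
    (hlim : Tendsto (fun x => localEntropy Q (transition Q) x / ℓ x)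
      (comap List.length atTop ⊓ 𝓟 (vertices Q)) (𝓝 h))
    -- (iii) the (absolutely convergent) local divergences are uniformly bounded
    (D : ℝ)
    (hD : ∀ x ∈ vertices Q,
      Summable (fun y : successors Q x => q' y x * Real.logb 2 (q' y x / transition Q y x)) ∧
      localDivergence Q q' (transition Q) x < D) :
    -- the series for `H(P_n)` and `ℓ(P_n)` converge absolutely, and the quotients are
    -- random variables
    (∀ n ω,
      Summable (fun x : level Q n =>
        levelMeasure Q (perturbed Q q' (fun k => ε k ω)) n x *
          Real.logb 2 (1 / levelMeasure Q (perturbed Q q' (fun k => ε k ω)) n x)) ∧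
      Summable (fun x : level Q n =>
        pathLength ℓ x * levelMeasure Q (perturbed Q q' (fun k => ε k ω)) n x)) ∧
    (∀ n, Measurable (fun ω =>
      entropy (levelMeasure Q (perturbed Q q' (fun k => ε k ω)) n) /
        expectedLength Q ℓ (perturbed Q q' (fun k => ε k ω)) n)) ∧
    -- convergence in probability
    (Tendsto (fun n => ∫ ω, ε n ω ∂μ) atTop (𝓝 0) →
      TendstoInMeasure μ
        (fun n ω => entropy (levelMeasure Q (perturbed Q q' (fun k => ε k ω)) n) /
          expectedLength Q ℓ (perturbed Q q' (fun k => ε k ω)) n)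
        atTop (fun _ => h)) ∧
    -- almost sure convergence
    ((∀ᵐ ω ∂μ, Tendsto (fun n => ε n ω) atTop (𝓝 0)) →
      ∀ᵐ ω ∂μ, Tendsto
        (fun n => entropy (levelMeasure Q (perturbed Q q' (fun k => ε k ω)) n) /
          expectedLength Q ℓ (perturbed Q q' (fun k => ε k ω)) n)
        atTop (𝓝 h)) := by
  have hq : IsForward Q (transition Q) := isForward_transition
  obtain ⟨B₁, hB₁⟩ := hq.exists_localEntropy_le hq_ent
  obtain ⟨B₂, hB₂⟩ := hq'.exists_localEntropy_le hq'_ent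
  set B := max B₁ B₂
  have hB : 0 ≤ B := ((hB₁ [] nil_mem_vertices).2.1.trans (hB₁ [] nil_mem_vertices).2.2).trans
    (le_max_left _ _)
  obtain ⟨δ, hδ, hδ_le⟩ := exists_tendsto_zero_bound hc₁ hℓ (fun x hx => (hB₁ x hx).2) hlim
  have hpert := fun (e : ℕ → ℝ) (he : ∀ k, e k ∈ Set.Icc (0 : ℝ) 1) (x : List S)
      (hx : x ∈ vertices Q) => hasSum_entropyTerm_perturbed (B := B) hq hq' he hx
    ⟨(hB₁ x hx).2.1, (hB₁ x hx).2.2.trans (le_max_left _ _)⟩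
    ⟨(hB₂ x hx).2.1, (hB₂ x hx).2.2.trans (le_max_right _ _)⟩ (hB₁ x hx).1 (hB₂ x hx).1
  have key := fun (e : ℕ → ℝ) (he : ∀ k, e k ∈ Set.Icc (0 : ℝ) 1) =>
    (hq.perturbed hq' he).entropy_sub_expectedLength hc₁ hℓ (h := h)
      (d := fun k => mixBound B (e k) + δ k)
      (fun x hx => (hpert e he x hx).1)
      fun x hx => (abs_sub_le _ (localEntropy Q (transition Q) x) _).trans
        (add_le_add (hpert e he x hx).2 (hδ_le x hx))
  have hmeas := measurable_entropy_div_expectedLength (Q := Q) q' ℓ hε_meas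
  have hbound : ∀ᶠ n in atTop, ∀ ω,
      |entropy (levelMeasure Q (perturbed Q q' fun k => ε k ω) n) /
        expectedLength Q ℓ (perturbed Q q' fun k => ε k ω) n - h| ≤
      c₁⁻¹ * ((n : ℝ)⁻¹ * ∑ k ∈ Finset.range n, (mixBound B (ε k ω) + δ k)) := by
    filter_upwards [eventually_ne_atTop 0] with n hn ω
    obtain ⟨-, -, h₁, h₂⟩ := key (fun k => ε k ω) (fun k => hε k ω) n
    exact abs_div_sub_le hn hc₁ h₁ h₂
  refine ⟨fun n ω => ?_, hmeas, fun hmean => ?_, fun has => ?_⟩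
  · obtain ⟨h₁, h₂, -, -⟩ := key (fun k => ε k ω) (fun k => hε k ω) n
    exact ⟨h₁, h₂⟩
  · obtain ⟨hint, hφ⟩ := tendsto_integral_mixBound hε_meas hε hB hmean
    have hint' : ∀ k, Integrable (fun ω => mixBound B (ε k ω) + δ k) μ := fun k =>
      (hint k).add (integrable_const _)
    refine tendstoInMeasure_of_abs_sub_le hmeas
      (fun n => ((integrable_finsetSum _ fun k _ => hint' k).const_mul _).const_mul _) hbound ?_
    have hsum := (hφ.add hδ).cesaro.const_mul c₁⁻¹
    rw [add_zero, mul_zero] at hsum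
    refine hsum.congr fun n => ?_
    rw [integral_const_mul, integral_const_mul, integral_finsetSum _ fun k _ => hint' k]
    congr 2
    refine Finset.sum_congr rfl fun k _ => ?_
    rw [integral_add (hint k) (integrable_const _), integral_const, probReal_univ, one_smul]
  · filter_upwards [has] with ω hω
    have hsum := (((tendsto_mixBound_zero B).comp hω).add hδ).cesaro.const_mul c₁⁻¹
    rw [add_zero, mul_zero] at hsum
    rw [tendsto_iff_dist_tendsto_zero]
    exact squeeze_zero' (Eventually.of_forall fun n => dist_nonneg)
      (hbound.mono fun n hn => hn ω) hsum
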